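/- For a graph $G$, a vertex $v$ and (possibly empty) sets $A_1,A_2$ with $A_1\cup A_2=\Gamma_G(v)$, the open neighbourhood of $v$, the \emph{$2$-stretching} of $v$ replaces $v$ by three vertices $v_0,v_1,v_2$ and, for $\ell=1,2$, joins $v_\ell$ to $v_0$ and to every vertex of $A_\ell$; all other vertices and edges are kept. For $n\ge 3$ and $d\ge 0$ let $\mathcal K_{n,d}$ be the set of graphs obtained from the complete graph $K_n$ on $[n]$ by $2$-stretching, one after the other, $d$ of its $n$ vertices, and let $D(G)\subseteq[n]$ be the set of the stretched vertices; thus $i\in D(G)$ is replaced by $i_0,i_1,i_2$. Let $$\mathrm{FRAC}(G)=\{x\in[0,1]^{V(G)}: x_u+x_v\le 1\ \ \forall\{u,v\}\in E(G)\},$$ and let $\mathrm{STAB}(G)$ be the convex hull of $\mathrm{FRAC}(G)\cap\{0,1\}^{V(G)}$. For $P\subseteq[0,1]^N$ let $\mathrm{CG}(P)$ be the set of all $x\in\mathbb R^N$ with $a^{\top}x\le\lfloor\beta\rfloor$ for all $a\in\mathbb Z^N$ and $\beta\in\mathbb R$ such that $a^{\top}y\le\beta$ for all $y\in P$. Put $\mathrm{CG}^0(P)=P$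 and $\mathrm{CG}^{\ell}(P)=\mathrm{CG}(\mathrm{CG}^{\ell-1}(P))$ for $\ell\ge1$. The \emph{Chvátal–Gomory rank}, relative to $\mathrm{FRAC}(G)$, of an inequality valid for $\mathrm{STAB}(G)$ is the smallest integer $\ell\ge 0$ for which it is valid for $\mathrm{CG}^{\ell}(\mathrm{FRAC}(G))$. \textbf{Proposition.} Let $G\in\mathcal K_{n,d}$ with $d\ge 1$ and $n\ge d+2$, and suppose that $\{i_1,j_1\}\notin E(G)$ and $\{i_2,j_2\}\notin E(G)$ for all distinct $i,j\in D(G)$. Then the inequality $\bar e^{\top}x\le d+1$, where $\bar e$ is the all-ones vector, is valid for $\mathrm{STAB}(G)$, and its Chvátal–Gomory rank relative to $\mathrm{FRAC}(G)$ is a well-defined non-negative integer that is at least $\log_4\left(\frac{3d-1}{2}\right)$. -/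

import Mathlib

/-- Names of the vertices of a graph obtained from the complete graph on `n` vertices by
2-stretching some of these vertices: an unstretched vertex `i`, and, for a stretched vertex `i`,
the hub `i₀` and the wings `i₁`, `i₂`. -/
inductive StretchLabel (n : ℕ) : Type
  | orig (i : Fin n)
  | hub (i : Fin n)
  | wing₁ (i : Fin n)
  | wing₂ (i : Fin n)

/-- The graph obtained from `G` by 2-stretching the vertex `v` with the sets `A₁`, `A₂`:
`v` is replaced by `v₀ = inr 0`, `v₁ = inr 1`, `v₂ = inr 2`, and for `j = 1, 2` the vertex `v_j` is
joined to `v₀` and to every vertex of `A_j`. -/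
def twoStretch {V : Type} (G : SimpleGraph V) (v : V) (A₁ A₂ : Set V) :
    SimpleGraph ({u : V // u ≠ v} ⊕ Fin 3) :=
  SimpleGraph.fromRel fun x y =>
    match x, y with
    | Sum.inl a, Sum.inl b => G.Adj a.1 b.1
    | Sum.inr 1, Sum.inr 0 => True
    | Sum.inr 2, Sum.inr 0 => True
    | Sum.inr 1, Sum.inl a => a.1 ∈ A₁
    | Sum.inr 2, Sum.inl a => a.1 ∈ A₂
    | _, _ => False

/-- The labelling of the vertices after the original vertex `i`, sitting at `v`, is stretched. -/
def twoStretchLabel {n : ℕ} {V : Type} (lab : V → StretchLabel n) (v : V) (i : Fin n) :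
    {u : V // u ≠ v} ⊕ Fin 3 → StretchLabel n
  | Sum.inl a => lab a.1
  | Sum.inr 0 => StretchLabel.hub i
  | Sum.inr 1 => StretchLabel.wing₁ i
  | Sum.inr 2 => StretchLabel.wing₂ i

/-- `BuiltByStretching n d G lab`: the graph `G`, whose vertices carry the names `lab`, is produced
from the complete graph on `n` vertices by 2-stretching `d` of its `n` vertices one after the other.
The sets `A₁`, `A₂` may be empty or equal to the whole neighbourhood. -/
inductive BuiltByStretching (n : ℕ) :
    ℕ → {V : Type} → SimpleGraph V → (V → StretchLabel n) → Prop
  | complete : BuiltByStretching n 0 (⊤ : SimpleGraph (Fin n)) StretchLabel.orig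
  | stretch {d : ℕ} {V : Type} {G : SimpleGraph V} {lab : V → StretchLabel n}
      (hG : BuiltByStretching n d G lab) (v : V) (i : Fin n) (hv : lab v = StretchLabel.orig i)
      (A₁ A₂ : Set V) (hA : A₁ ∪ A₂ = G.neighborSet v) :
      BuiltByStretching n (d + 1) (twoStretch G v A₁ A₂) (twoStretchLabel lab v i)

/-- `G`, with vertices named by `lab`, is a stretched clique with parameters `n`, `d`, that is, a
graph obtained from the complete graph on `n` vertices by 2-stretching `d` of its vertices (on an
arbitrary vertex type, up to a label-preserving isomorphism). -/
def IsStretchedClique (n d : ℕ) {V : Type*} (G : SimpleGraph V) (lab : V → StretchLabel n) : Prop :=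
  ∃ (W : Type) (H : SimpleGraph W) (labH : W → StretchLabel n) (e : G ≃g H),
    BuiltByStretching n d H labH ∧ ∀ v, lab v = labH (e v)

/-- The fractional stable set polytope. -/
def fracPolytope {V : Type*} (G : SimpleGraph V) : Set (V → ℝ) :=
  {x | (∀ v, 0 ≤ x v ∧ x v ≤ 1) ∧ ∀ u v, G.Adj u v → x u + x v ≤ 1}

/-- The integer hull `P_I`: the convex hull of the 0,1-vectors in `P`. -/
def integerHull {V : Type*} (P : Set (V → ℝ)) : Set (V → ℝ) :=
  convexHull ℝ {x | x ∈ P ∧ ∀ v, x v = 0 ∨ x v = 1}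

/-- The stable set polytope. -/
def stabPolytope {V : Type*} (G : SimpleGraph V) : Set (V → ℝ) :=
  integerHull (fracPolytope G)

/-- The inequality `aᵀx ≤ β`, with integral `a`, is valid for `P`. -/
def ValidFor {V : Type*} [Fintype V] (P : Set (V → ℝ)) (a : V → ℤ) (β : ℝ) : Prop :=
  ∀ x ∈ P, ∑ v, (a v : ℝ) * x v ≤ β

/-- The Chvátal–Gomory closure: the points that satisfy all Chvátal–Gomory cuts of `P`. -/
def cgClosure {V : Type*} [Fintype V] (P : Set (V → ℝ)) : Set (V → ℝ) :=
  {x | ∀ (a : V → ℤ) (β : ℝ), ValidFor P a β → ∑ v, (a v : ℝ) * x v ≤ (⌊β⌋ : ℝ)}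

/-- `r` is the Chvátal–Gomory rank of `aᵀx ≤ β` relative to `P`: the smallest `ℓ` such that the
inequality is valid for the `ℓ`-th iterated closure (the `0`-th one being `P` itself). -/
def IsCGRank {V : Type*} [Fintype V] (P : Set (V → ℝ)) (a : V → ℤ) (β : ℝ) (r : ℕ) : Prop :=
  IsLeast {l : ℕ | ValidFor (cgClosure^[l] P) a β} r

/-! Validity rests on the stability number: a stretching raises it by at most one, so a stable set
has at most d + 1 vertices. Finiteness of the rank is a general fact about rank inequalities:
averaging the inequalities for the sets U minus a vertex and rounding gives the one for U
(`validFor_iterate_cgClosure_rank`).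

For the lower bound, the hubs form a stable set of size d, and it stays stable when the hub of a
single i is exchanged for its two wings. All these 0,1-points survive every closure. Starting from
the hubs and performing every exchange with weight 1 / 2 gives a point of the fractional polytope,
and each round of cuts pushes it only part of the way towards the hubs: with weight 1 / (2 ^ r + 1)
the point is still in the r-th closure (`mem_iterate_cgClosure`). Its coordinate sum is d + d / (2 ^
r + 1), which exceeds d + 1 as soon as 2 ^ r + 1 < d. For r ≥ 1 this follows from 4 ^ r < (3d - 1) /
2; for r = 0 the all-halves point is used instead. -/

/-! ### Points that survive iterated Chvátal–Gomory closures. -/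

section ChvatalGomory

variable {V : Type*} [Fintype V]

/-- Integral points survive the Chvátal–Gomory closure. -/
theorem intCast_mem_cgClosure {P : Set (V → ℝ)} {y : V → ℤ} (hy : (fun v => (y v : ℝ)) ∈ P) :
    (fun v => (y v : ℝ)) ∈ cgClosure P := by
  intro a β h
  have h1 := h _ hy
  have h2 : ((∑ v, a v * y v : ℤ) : ℝ) ≤ β := by push_cast; exact h1
  have h3 : (∑ v, a v * y v : ℤ) ≤ ⌊β⌋ := Int.le_floor.2 h2
  have h4 : ((∑ v, a v * y v : ℤ) : ℝ) ≤ (⌊β⌋ : ℝ) := by exact_mod_cast h3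
  push_cast at h4
  exact h4

theorem intCast_mem_iterate_cgClosure {P : Set (V → ℝ)} {y : V → ℤ}
    (hy : (fun v => (y v : ℝ)) ∈ P) (r : ℕ) : (fun v => (y v : ℝ)) ∈ cgClosure^[r] P := by
  induction r with
  | zero => exact hy
  | succ r ih =>
    rw [Function.iterate_succ_apply']
    exact intCast_mem_cgClosure ih

theorem ValidFor.cgClosure_of_lt {P : Set (V → ℝ)} {a : V → ℤ} {β : ℝ} {b : ℤ}
    (h : ValidFor P a β) (hb : β < b + 1) : ValidFor (cgClosure P) a b := by
  intro x hx
  refine (hx a β h).trans ?_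
  have : ⌊β⌋ < b + 1 := Int.floor_lt.2 (by push_cast; exact hb)
  exact_mod_cast Int.lt_add_one_iff.1 this

theorem ValidFor.iterate_cgClosure {P : Set (V → ℝ)} {a : V → ℤ} {b : ℤ}
    (h : ValidFor P a b) (r : ℕ) : ValidFor (cgClosure^[r] P) a b := by
  induction r with
  | zero => exact h
  | succ r ih =>
    rw [Function.iterate_succ_apply']
    exact ih.cgClosure_of_lt (by linarith)

/-- If the integral points `y` and `y + z i` and the point `y + (∑ i, z i) / 2` lie in `P`, then
`y + (∑ i, z i) / (2 ^ r + 1)` lies in the `r`-th Chvátal–Gomory closure of `P`. -/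
theorem mem_iterate_cgClosure {ι : Type*} [Fintype ι] {P : Set (V → ℝ)} (y : V → ℤ)
    (z : ι → V → ℤ) (hy : (fun v => (y v : ℝ)) ∈ P)
    (hz : ∀ i, (fun v => ((y v + z i v : ℤ) : ℝ)) ∈ P)
    (hhalf : (fun v => (y v : ℝ) + (∑ i, (z i v : ℝ)) / 2) ∈ P) (r : ℕ) :
    (fun v => (y v : ℝ) + (∑ i, (z i v : ℝ)) / (2 ^ r + 1)) ∈ cgClosure^[r] P := by
  induction r with
  | zero => norm_num; exact hhalf
  | succ r ih =>
    rw [Function.iterate_succ_apply']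
    intro a β h
    obtain ⟨A, hA⟩ : ∃ A : ℤ, A = ∑ v, a v * y v := ⟨_, rfl⟩
    obtain ⟨C, hC⟩ : ∃ C : ι → ℤ, ∀ i, C i = ∑ v, a v * z i v := ⟨_, fun _ => rfl⟩
    have eval : ∀ t : ℝ, ∑ v, (a v : ℝ) * ((y v : ℝ) + (∑ i, (z i v : ℝ)) / t)
        = A + ((∑ i, C i : ℤ) : ℝ) / t := by
      intro t
      have hW : ((∑ i, C i : ℤ) : ℝ) = ∑ v, (a v : ℝ) * ∑ i, (z i v : ℝ) := by
        simp only [hC, Finset.mul_sum]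
        push_cast
        exact Finset.sum_comm
      rw [hW, hA, Finset.sum_div]
      push_cast
      rw [← Finset.sum_add_distrib]
      exact Finset.sum_congr rfl fun v _ => by ring
    have hAβ : A ≤ ⌊β⌋ := by
      refine Int.le_floor.2 ?_
      rw [hA]
      push_cast
      exact h _ (intCast_mem_iterate_cgClosure hy r)
    have hCβ : ∀ i, A + C i ≤ ⌊β⌋ := by
      intro i
      refine Int.le_floor.2 ?_
      have := h _ (intCast_mem_iterate_cgClosure (hz i) r)
      rw [hA, hC, ← Finset.sum_add_distrib]
      simp only [← mul_add]
      push_cast at this ⊢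
      exact this
    have hx := h _ ih
    rw [eval] at hx ⊢
    generalize hWdef : (∑ i, C i) = W at hx ⊢
    obtain ⟨B, hB⟩ : ∃ B : ℤ, ⌊β⌋ = A + B := ⟨⌊β⌋ - A, by ring⟩
    have hm : (0 : ℝ) < 2 ^ r + 1 := by positivity
    have hβ : β < A + B + 1 := by
      have := Int.lt_floor_add_one β
      rw [hB] at this
      push_cast at this
      exact this
    -- Here B is the slack that the rounded cut leaves at y, and W is the total gain of all the
    -- moves z i.
    have hW1 : W < (2 ^ r + 1) * (B + 1) := by
      have : (W : ℝ) / (2 ^ r + 1) < B + 1 := by linarith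
      rw [div_lt_iff₀ hm] at this
      have h' : (W : ℝ) < (((2 ^ r + 1) * (B + 1) : ℤ) : ℝ) := by push_cast; linarith
      exact_mod_cast h'
    -- If B = 0, no single move gains anything, since y + z i satisfies the cut; hence W ≤ 0. If B ≥
    -- 1, then (2 ^ r + 1)(B + 1) - 1 ≤ B(2 ^ (r + 1) + 1), the difference being 2 ^ r (B - 1).
    have hW2 : W ≤ B * (2 ^ (r + 1) + 1) := by
      have hB0 : 0 ≤ B := by omega
      have hp : (0 : ℤ) ≤ 2 ^ r := by positivity
      rcases hB0.eq_or_lt with hB0 | hB0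
      · rw [← hB0, zero_mul, ← hWdef]
        refine Finset.sum_nonpos fun i _ => ?_
        have := hCβ i
        omega
      · have : 0 ≤ (2 : ℤ) ^ r * (B - 1) := mul_nonneg hp (by omega)
        rw [pow_succ]
        linarith
    rw [hB]
    push_cast
    have : (W : ℝ) / (2 ^ (r + 1) + 1) ≤ B := by
      rw [div_le_iff₀ (by positivity)]
      exact_mod_cast hW2
    linarith

end ChvatalGomory

/-! ### Rank inequalities of stable sets: finite rank and validity. -/

section StableSets

variable {V : Type*} [Fintype V] {G : SimpleGraph V}

/-- The rank inequality of a vertex set `U` is valid for the `#U`-th Chvátal–Gomory closure of the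
fractional stable set polytope. -/
theorem validFor_iterate_cgClosure_rank [DecidableEq V] (b : ℕ) (U : Finset V)
    (hU : ∀ S ⊆ U, (∀ u ∈ S, ∀ v ∈ S, ¬ G.Adj u v) → S.card ≤ b) :
    ValidFor (cgClosure^[U.card] (fracPolytope G)) (fun v => if v ∈ U then 1 else 0)
      ((b : ℤ) : ℝ) := by
  obtain ⟨k, hk⟩ : ∃ k, U.card = k := ⟨_, rfl⟩
  induction k generalizing U with
  | zero =>
    rw [Finset.card_eq_zero] at hk
    subst hk
    intro x _
    simp
  | succ k ih =>
    by_cases hst : ∀ u ∈ U, ∀ v ∈ U, ¬ G.Adj u v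
    · refine ValidFor.iterate_cgClosure (fun x hx => ?_) _
      have h1 : ∑ v ∈ U, x v ≤ ∑ v ∈ U, 1 := Finset.sum_le_sum fun v _ => (hx.1 v).2
      have h2 : (U.card : ℝ) ≤ b := by exact_mod_cast hU U subset_rfl hst
      simp only [Int.cast_ite, Int.cast_one, Int.cast_zero, ite_mul, one_mul, zero_mul,
        Finset.sum_ite_mem, Finset.univ_inter]
      simp only [Finset.sum_const, nsmul_eq_mul, mul_one] at h1
      exact h1.trans (by exact_mod_cast h2)
    push Not at hst
    obtain ⟨u, hu, w, hw, huw⟩ := hst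
    -- With at most b + 1 vertices in U, one edge inside U suffices: it contributes at most 1 and
    -- the other k - 1 vertices at most 1 each.
    by_cases hb : k ≤ b
    · refine ValidFor.iterate_cgClosure (fun x hx => ?_) _
      simp only [Int.cast_ite, Int.cast_one, Int.cast_zero, ite_mul, one_mul, zero_mul,
        Finset.sum_ite_mem, Finset.univ_inter]
      have hw' : w ∈ U.erase u := Finset.mem_erase.2 ⟨huw.ne', hw⟩
      have hcard : ((U.erase u).erase w).card + 1 = k := by
        have h1 := Finset.card_erase_add_one hw'
        have h2 := Finset.card_erase_add_one hu
        omega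
      have h1 : ∑ v ∈ (U.erase u).erase w, x v ≤ ∑ v ∈ (U.erase u).erase w, 1 :=
        Finset.sum_le_sum fun v _ => (hx.1 v).2
      simp only [Finset.sum_const, nsmul_eq_mul, mul_one] at h1
      rw [← Finset.add_sum_erase U x hu, ← Finset.add_sum_erase _ x hw']
      have h2 := hx.2 u w huw
      have h3 : (((U.erase u).erase w).card : ℝ) + 1 ≤ b := by
        exact_mod_cast hcard.trans_le hb
      push_cast
      linarith
    · have hbk : b < k := by omega
      have hk0 : (0 : ℝ) < k := by exact_mod_cast (Nat.zero_le b).trans_lt hbk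
      rw [hk, Function.iterate_succ_apply']
      -- Summing the inequalities of the k + 1 sets `U.erase v` counts every vertex k times. The
      -- resulting bound b + b / k is below b + 1 because b < k, so rounding gives b.
      have key : ValidFor (cgClosure^[k] (fracPolytope G)) (fun v => if v ∈ U then 1 else 0)
          ((k + 1) * b / k) := by
        intro x hx
        have hv : ∀ v ∈ U, ∑ t ∈ U, x t - x v ≤ b := by
          intro v hv
          have hc : (U.erase v).card = k := by
            rw [Finset.card_erase_of_mem hv, hk]; rfl
          have := ih (U.erase v)
            (fun S hS hS' => hU S (hS.trans (Finset.erase_subset _ _)) hS') hc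
          rw [hc] at this
          have := this x hx
          simp only [Int.cast_ite, Int.cast_one, Int.cast_zero, ite_mul, one_mul, zero_mul,
            Finset.sum_ite_mem, Finset.univ_inter, Int.cast_natCast] at this
          rw [← Finset.add_sum_erase U x hv]
          linarith
        have hsum := Finset.sum_le_sum hv
        simp only [Finset.sum_sub_distrib, Finset.sum_const, nsmul_eq_mul, hk] at hsum
        push_cast at hsum
        simp only [Int.cast_ite, Int.cast_one, Int.cast_zero, ite_mul, one_mul, zero_mul,
          Finset.sum_ite_mem, Finset.univ_inter]
        rw [le_div_iff₀ hk0]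
        linarith
      refine key.cgClosure_of_lt ?_
      rw [div_lt_iff₀ hk0]
      have : (b : ℝ) < k := by exact_mod_cast hbk
      push_cast
      linarith

theorem validFor_stabPolytope (b : ℕ)
    (h : ∀ S : Finset V, (∀ u ∈ S, ∀ v ∈ S, ¬ G.Adj u v) → S.card ≤ b) :
    ValidFor (stabPolytope G) (fun _ => 1) b := by
  classical
  have hconv : Convex ℝ {x : V → ℝ | ∑ v, x v ≤ b} := by
    refine convex_halfSpace_le ?_ _
    exact ⟨fun x y => Finset.sum_add_distrib, fun c x => by simp [Finset.mul_sum]⟩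
  have hsub : stabPolytope G ⊆ {x : V → ℝ | ∑ v, x v ≤ b} := by
    refine convexHull_min ?_ hconv
    rintro x ⟨hx, h01⟩
    have hx' : ∀ v, x v = if x v = 1 then 1 else 0 := fun v => by
      rcases h01 v with h | h <;> simp [h]
    have hS := h (Finset.univ.filter fun v => x v = 1) (by
      intro u hu v hv huv
      rw [Finset.mem_filter] at hu hv
      have := hx.2 u v huv
      rw [hu.2, hv.2] at this
      norm_num at this)
    change ∑ v, x v ≤ b
    rw [Finset.sum_congr rfl fun v _ => hx' v, Finset.sum_boole]
    exact_mod_cast hS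
  intro x hx
  simpa using hsub hx

end StableSets

/-! ### Structure of graphs built by successive stretchings. -/

section Stretching

/-- The original vertex that a label comes from. -/
def StretchLabel.index {n : ℕ} : StretchLabel n → Fin n
  | .orig i => i
  | .hub i => i
  | .wing₁ i => i
  | .wing₂ i => i

/-- The function on labels with value `o` on unstretched vertices, `h` on hubs and `w` on wings. -/
def StretchLabel.weight {n : ℕ} {R : Type*} (o h w : R) : StretchLabel n → R
  | .orig _ => o
  | .hub _ => h
  | .wing₁ _ => w
  | .wing₂ _ => w

/-- The label is that of one of the two wings of `i`. -/
def StretchLabel.IsWing {n : ℕ} (l : StretchLabel n) (i : Fin n) : Prop :=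
  l = .wing₁ i ∨ l = .wing₂ i

theorem StretchLabel.IsWing.index_eq {n : ℕ} {l : StretchLabel n} {i : Fin n} (h : l.IsWing i) :
    l.index = i := by
  rcases h with rfl | rfl <;> rfl

section Adjacency

variable {V : Type} {G : SimpleGraph V} {v : V} {A₁ A₂ : Set V}

theorem twoStretch_adj_inl_inl {a b : {u : V // u ≠ v}} :
    (twoStretch G v A₁ A₂).Adj (.inl a) (.inl b) ↔ G.Adj a.1 b.1 := by
  simp only [twoStretch, SimpleGraph.fromRel_adj]
  constructor
  · rintro ⟨-, h | h⟩
    exacts [h, h.symm]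
  · intro h
    refine ⟨fun hab => ?_, Or.inl h⟩
    rw [Sum.inl.inj hab] at h
    exact G.loopless.irrefl _ h

theorem twoStretch_adj_inl_inr {a : {u : V // u ≠ v}} {k : Fin 3} :
    (twoStretch G v A₁ A₂).Adj (.inl a) (.inr k) ↔ (k = 1 ∧ a.1 ∈ A₁) ∨ (k = 2 ∧ a.1 ∈ A₂) := by
  fin_cases k <;> simp [twoStretch, SimpleGraph.fromRel_adj]

theorem twoStretch_adj_inr_inr {k l : Fin 3} :
    (twoStretch G v A₁ A₂).Adj (.inr k) (.inr l) ↔ (k = 0 ∧ l ≠ 0) ∨ (k ≠ 0 ∧ l = 0) := by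
  fin_cases k <;> fin_cases l <;> simp [twoStretch, SimpleGraph.fromRel_adj]

end Adjacency

variable {n d : ℕ} {V : Type} {G : SimpleGraph V} {lab : V → StretchLabel n}

/-- Undoing the last stretching costs a stable set at most one vertex. If both wings are in S, the
hub is not, and S has no vertex in A₁ ∪ A₂, so the two wings can be replaced by v. Otherwise S
contains at most one of the three new vertices, which is dropped. -/
theorem BuiltByStretching.card_le (hG : BuiltByStretching n d G lab) (S : Finset V)
    (hS : ∀ u ∈ S, ∀ v ∈ S, ¬ G.Adj u v) : S.card ≤ d + 1 := by
  classical
  induction hG with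
  | complete =>
    refine Finset.card_le_one.2 fun u hu v hv => ?_
    by_contra h
    exact hS u hu v hv h
  | @stretch d V G lab hG v i hv A₁ A₂ hA ih =>
    let T : Finset V := S.toLeft.map ⟨Subtype.val, Subtype.val_injective⟩
    have memT : ∀ u ∈ T, ∃ hu : u ≠ v, Sum.inl ⟨u, hu⟩ ∈ S := by
      intro u hu
      simp only [T, Finset.mem_map, Finset.mem_toLeft, Function.Embedding.coeFn_mk] at hu
      obtain ⟨a, ha, rfl⟩ := hu
      exact ⟨a.2, ha⟩
    have hT : ∀ u ∈ T, ∀ w ∈ T, ¬ G.Adj u w := by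
      intro u hu w hw huw
      obtain ⟨hu', hu⟩ := memT u hu
      obtain ⟨hw', hw⟩ := memT w hw
      exact hS _ hu _ hw (twoStretch_adj_inl_inl.2 huw)
    have hcard : S.card = T.card + S.toRight.card := by
      rw [Finset.card_map, Finset.card_toLeft_add_card_toRight]
    by_cases h12 : (1 : Fin 3) ∈ S.toRight ∧ (2 : Fin 3) ∈ S.toRight
    · have hR : S.toRight ⊆ {1, 2} := by
        intro k hk
        by_contra hk'
        have hk0 : k = 0 := by fin_cases k <;> simp_all
        subst hk0
        exact hS _ (Finset.mem_toRight.1 hk) _ (Finset.mem_toRight.1 h12.1)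
          (twoStretch_adj_inr_inr.2 (by decide))
      have hR' := (Finset.card_le_card hR).trans Finset.card_le_two
      have hvT : v ∉ T := fun h => (memT v h).1 rfl
      have hTv : ∀ w ∈ T, ¬ G.Adj v w := by
        intro w hw hvw
        obtain ⟨hw', hw⟩ := memT w hw
        have hmem : w ∈ A₁ ∪ A₂ := by rw [hA]; exact hvw
        rcases hmem with h | h
        · exact hS _ hw _ (Finset.mem_toRight.1 h12.1)
            (twoStretch_adj_inl_inr.2 (Or.inl ⟨rfl, h⟩))
        · exact hS _ hw _ (Finset.mem_toRight.1 h12.2)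
            (twoStretch_adj_inl_inr.2 (Or.inr ⟨rfl, h⟩))
      have := ih (insert v T) (by
        intro u hu w hw huw
        rcases Finset.mem_insert.1 hu with rfl | hu' <;>
          rcases Finset.mem_insert.1 hw with rfl | hw'
        · exact G.loopless.irrefl _ huw
        · exact hTv _ hw' huw
        · exact hTv _ hu' huw.symm
        · exact hT _ hu' _ hw' huw)
      rw [Finset.card_insert_of_notMem hvT] at this
      omega
    · have hR : S.toRight.card ≤ 1 := by
        refine Finset.card_le_one.2 fun k hk l hl => ?_
        have := hS _ (Finset.mem_toRight.1 hk) _ (Finset.mem_toRight.1 hl)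
        rw [twoStretch_adj_inr_inr] at this
        fin_cases k <;> fin_cases l <;> simp_all
      have := ih T hT
      omega

/-- Only a stretching creates further vertices of an index, and it deletes the unstretched one. This
separates the new vertices of a stretching from all older ones by their index. -/
theorem BuiltByStretching.eq_of_index_eq (hG : BuiltByStretching n d G lab) {u w : V} {i : Fin n}
    (hu : lab u = .orig i) (hw : (lab w).index = i) : u = w := by
  induction hG with
  | complete =>
    cases hu
    exact hw.symm
  | @stretch d V G lab hG v j hv A₁ A₂ hA ih =>
    rcases u with a | k
    · rcases w with b | l
      · exact congrArg _ (Subtype.ext (ih hu hw))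
      · have hij : j = i := by rw [← hw]; fin_cases l <;> rfl
        have := ih hu (w := v) (by rw [hv, hij]; rfl)
        exact absurd this a.2
    · fin_cases k <;> cases hu

/-- A new hub is joined only to its own wings. Later stretchings act on unstretched vertices, which
by induction are not adjacent to a hub, so they leave its neighbourhood alone. -/
theorem BuiltByStretching.isWing_of_adj_hub (hG : BuiltByStretching n d G lab) {u w : V}
    {i : Fin n} (hu : lab u = .hub i) (huw : G.Adj u w) : (lab w).IsWing i := by
  induction hG with
  | complete => cases hu
  | @stretch d V G lab hG v j hv A₁ A₂ hA ih =>
    rcases u with a | k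
    · rcases w with b | l
      · exact ih hu (twoStretch_adj_inl_inl.1 huw)
      · exfalso
        have ha : a.1 ∈ A₁ ∪ A₂ := by
          rcases twoStretch_adj_inl_inr.1 huw with h | h
          exacts [Or.inl h.2, Or.inr h.2]
        rw [hA] at ha
        have := ih hu (SimpleGraph.Adj.symm ha)
        rw [hv] at this
        rcases this with h | h <;> cases h
    · have hk : k = 0 := by fin_cases k <;> first | rfl | cases hu
      subst hk
      cases hu
      rcases w with b | l
      · rcases twoStretch_adj_inl_inr.1 huw.symm with h | h <;> exact absurd h.1 (by decide)
      · rw [twoStretch_adj_inr_inr] at huw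
        fin_cases l
        · simp at huw
        · exact Or.inl rfl
        · exact Or.inr rfl

theorem BuiltByStretching.not_adj_of_isWing (hG : BuiltByStretching n d G lab) {u w : V}
    {i : Fin n} (hu : (lab u).IsWing i) (hw : (lab w).IsWing i) : ¬ G.Adj u w := by
  induction hG with
  | complete => rcases hu with h | h <;> cases h
  | @stretch d V G lab hG v j hv A₁ A₂ hA ih =>
    -- Wings of one index arise in the same stretching: an older vertex of index j would have to be
    -- v itself.
    have mixed : ∀ (a : {u : V // u ≠ v}) (k : Fin 3),
        (twoStretchLabel lab v j (.inl a)).IsWing i →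
        ¬ (twoStretchLabel lab v j (.inr k)).IsWing i := by
      intro a k ha hk
      have hij : j = i := by rw [← hk.index_eq]; fin_cases k <;> rfl
      exact a.2 (hG.eq_of_index_eq hv (by rw [hij]; exact ha.index_eq)).symm
    rcases u with a | k
    · rcases w with b | l
      · rw [twoStretch_adj_inl_inl]
        exact ih hu hw
      · exact absurd hw (mixed a l hu)
    · rcases w with b | l
      · exact absurd hu (mixed b k hw)
      · have hk : k ≠ 0 := by rintro rfl; rcases hu with h | h <;> cases h
        have hl : l ≠ 0 := by rintro rfl; rcases hw with h | h <;> cases h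
        rw [twoStretch_adj_inr_inr]
        tauto

/-- The vertex type is not assumed finite, so finiteness is produced by the same induction: each
stretching trades one weight o for h + 2w. -/
theorem BuiltByStretching.sum_weight (hG : BuiltByStretching n d G lab) (o h w : ℝ) :
    ∃ _ : Fintype V, ∑ v, (lab v).weight o h w = (n - d) * o + d * (h + 2 * w) := by
  classical
  induction hG with
  | complete => exact ⟨inferInstance, by simp [StretchLabel.weight]⟩
  | @stretch d V G lab hG v j hv A₁ A₂ hA ih =>
    obtain ⟨_, ih⟩ := ih
    refine ⟨inferInstance, ?_⟩
    rw [Fintype.sum_sum_type, Fin.sum_univ_three]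
    have h1 : ∑ a : {u : V // u ≠ v}, (lab a.1).weight o h w
        = ∑ u, (lab u).weight o h w - o := by
      rw [Fintype.sum_eq_add_sum_subtype_ne (fun u => (lab u).weight o h w) v, hv]
      simp [StretchLabel.weight]
    change ∑ a : {u : V // u ≠ v}, (lab a.1).weight o h w + (h + w + w) = _
    rw [h1, ih]
    push_cast
    ring

end Stretching

/-! ### The surviving point of a stretched clique and the rank bound. -/

section StretchedClique

variable {n d : ℕ} {V : Type*} {G : SimpleGraph V} {lab : V → StretchLabel n}

theorem IsStretchedClique.card_le (hG : IsStretchedClique n d G lab) (S : Finset V)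
    (hS : ∀ u ∈ S, ∀ v ∈ S, ¬ G.Adj u v) : S.card ≤ d + 1 := by
  obtain ⟨W, H, labH, e, hH, -⟩ := hG
  rw [← Finset.card_map e.toEquiv.toEmbedding]
  refine hH.card_le _ fun u hu v hv huv => ?_
  obtain ⟨u, hu', rfl⟩ := Finset.mem_map.1 hu
  obtain ⟨v, hv', rfl⟩ := Finset.mem_map.1 hv
  exact hS u hu' v hv' (e.map_adj_iff.1 huv)

theorem IsStretchedClique.isWing_of_adj_hub (hG : IsStretchedClique n d G lab) {u w : V}
    {i : Fin n} (hu : lab u = .hub i) (huw : G.Adj u w) : (lab w).IsWing i := by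
  obtain ⟨W, H, labH, e, hH, he⟩ := hG
  rw [he] at hu ⊢
  exact hH.isWing_of_adj_hub hu (e.map_adj_iff.2 huw)

theorem IsStretchedClique.not_adj_of_isWing (hG : IsStretchedClique n d G lab) {u w : V}
    {i : Fin n} (hu : (lab u).IsWing i) (hw : (lab w).IsWing i) : ¬ G.Adj u w := by
  obtain ⟨W, H, labH, e, hH, he⟩ := hG
  rw [he] at hu hw
  exact fun h => hH.not_adj_of_isWing hu hw (e.map_adj_iff.2 h)

theorem IsStretchedClique.sum_weight [Fintype V] (hG : IsStretchedClique n d G lab)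
    (o h w : ℝ) : ∑ v, (lab v).weight o h w = (n - d) * o + d * (h + 2 * w) := by
  obtain ⟨W, H, labH, e, hH, he⟩ := hG
  obtain ⟨_, hsum⟩ := hH.sum_weight o h w
  rw [← hsum]
  exact Fintype.sum_equiv e.toEquiv _ _ fun v => by rw [he]; rfl

/-- The label function that, added to the indicator of the hubs, exchanges the hub of `i` for its
two wings. -/
def StretchLabel.swap {n : ℕ} (i : Fin n) : StretchLabel n → ℤ
  | .orig _ => 0
  | .hub j => if j = i then -1 else 0
  | .wing₁ j => if j = i then 1 else 0
  | .wing₂ j => if j = i then 1 else 0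

theorem StretchLabel.sum_swap (l : StretchLabel n) :
    ∑ i, (swap i l : ℝ) = l.weight 0 (-1) 1 := by
  cases l <;> simp [swap, weight]

/-- A 0,1-valued function on the vertices without two adjacent ones lies in the fractional stable
set polytope. -/
theorem intCast_mem_fracPolytope {y : V → ℤ} (h01 : ∀ v, y v = 0 ∨ y v = 1)
    (hy : ∀ u v, y u = 1 → y v = 1 → ¬ G.Adj u v) : (fun v => (y v : ℝ)) ∈ fracPolytope G := by
  refine ⟨fun v => ?_, fun u v huv => ?_⟩
  · rcases h01 v with h | h <;> simp [h]
  · rcases h01 u with h | h <;> rcases h01 v with h' | h'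
    · simp [h, h']
    · simp [h, h']
    · simp [h, h']
    · exact absurd huv (hy u v h h')

/-- This is `mem_iterate_cgClosure` with y the indicator of the hubs and z i the exchange of the hub
of i for its wings. The exchanges touch disjoint sets of vertices, so their sum is -1 on every hub
and 1 on every wing. -/
theorem IsStretchedClique.weight_mem_iterate_cgClosure [Fintype V]
    (hG : IsStretchedClique n d G lab) (r : ℕ) :
    (fun v => (lab v).weight 0 (1 - 1 / (2 ^ r + 1)) (1 / (2 ^ r + 1) : ℝ)) ∈
      cgClosure^[r] (fracPolytope G) := by
  have hhub : ∀ v, (lab v).weight (0 : ℤ) 1 0 = 1 → ∃ i, lab v = .hub i := by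
    intro v hv
    generalize lab v = l at hv ⊢
    cases l <;> simp_all [StretchLabel.weight]
  have hswap : ∀ i v, (lab v).weight (0 : ℤ) 1 0 + (lab v).swap i = 1 →
      (∃ j, j ≠ i ∧ lab v = .hub j) ∨ (lab v).IsWing i := by
    intro i v hv
    generalize lab v = l at hv ⊢
    cases l with
    | orig j => simp [StretchLabel.weight, StretchLabel.swap] at hv
    | hub j =>
      refine Or.inl ⟨j, ?_, rfl⟩
      rintro rfl
      simp [StretchLabel.weight, StretchLabel.swap] at hv
    | wing₁ j =>
      have : j = i := by
        by_contra h
        simp [StretchLabel.weight, StretchLabel.swap, h] at hv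
      exact Or.inr (Or.inl (by rw [this]))
    | wing₂ j =>
      have : j = i := by
        by_contra h
        simp [StretchLabel.weight, StretchLabel.swap, h] at hv
      exact Or.inr (Or.inr (by rw [this]))
  have hnot : ∀ {u v i}, lab u = .hub i → ∀ {j}, lab v = .hub j → ¬ G.Adj u v := by
    intro u v i hu j hv huv
    have := hG.isWing_of_adj_hub hu huv
    rw [hv] at this
    rcases this with h | h <;> cases h
  have hnot' : ∀ {u v i j}, j ≠ i → lab u = .hub j → (lab v).IsWing i → ¬ G.Adj u v :=
    fun hji hu hv huv => hji ((hG.isWing_of_adj_hub hu huv).index_eq.symm.trans hv.index_eq)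
  have main := mem_iterate_cgClosure (P := fracPolytope G)
    (fun v => (lab v).weight (0 : ℤ) 1 0) (fun i v => (lab v).swap i) ?_ ?_ ?_ r
  · convert main using 2 with v
    rw [StretchLabel.sum_swap]
    generalize lab v = l
    cases l <;> simp [StretchLabel.weight] <;> ring
  · refine intCast_mem_fracPolytope (fun v => ?_) fun u v hu hv => ?_
    · generalize lab v = l
      cases l <;> simp [StretchLabel.weight]
    · obtain ⟨i, hi⟩ := hhub u hu
      obtain ⟨j, hj⟩ := hhub v hv
      exact hnot hi hj
  · intro i
    refine intCast_mem_fracPolytope (fun v => ?_) fun u v hu hv => ?_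
    · generalize lab v = l
      cases l <;> simp only [StretchLabel.weight, StretchLabel.swap] <;> (try split_ifs) <;> simp
    · rcases hswap i u hu with ⟨j, hji, hj⟩ | hu' <;>
        rcases hswap i v hv with ⟨k, hki, hk⟩ | hv'
      · exact hnot hj hk
      · exact hnot' hji hj hv'
      · exact fun h => hnot' hki hk hu' h.symm
      · exact hG.not_adj_of_isWing hu' hv'
  -- The half-way point takes only the values 0 and 1 / 2, so every edge constraint holds.
  · have hle : ∀ v, 0 ≤ (((lab v).weight (0 : ℤ) 1 0 : ℤ) : ℝ)
          + (∑ i, ((lab v).swap i : ℝ)) / 2 ∧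
        (((lab v).weight (0 : ℤ) 1 0 : ℤ) : ℝ) + (∑ i, ((lab v).swap i : ℝ)) / 2 ≤ 1 / 2 := by
      intro v
      rw [StretchLabel.sum_swap]
      generalize lab v = l
      cases l <;> norm_num [StretchLabel.weight]
    refine ⟨fun v => ⟨(hle v).1, (hle v).2.trans (by norm_num)⟩, fun u v _ => ?_⟩
    have h1 := (hle u).2
    have h2 := (hle v).2
    simp only at h1 h2 ⊢
    linarith

theorem IsStretchedClique.exists_lt_sum [Fintype V] (hG : IsStretchedClique n d G lab)
    (hd : 1 ≤ d) (hn : d + 2 ≤ n) {r : ℕ} (hr : (4 : ℝ) ^ r < (3 * d - 1) / 2) :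
    ∃ x ∈ cgClosure^[r] (fracPolytope G), (d : ℝ) + 1 < ∑ v, x v := by
  have hd' : (1 : ℝ) ≤ d := by exact_mod_cast hd
  have hn' : (d : ℝ) + 2 ≤ n := by exact_mod_cast hn
  -- For r = 0 the surviving point has sum only 3d / 2, too little when d = 2. The all-halves point
  -- has sum n / 2 + d, and n ≥ d + 2 makes this large enough.
  rcases Nat.eq_zero_or_pos r with rfl | hr0
  · refine ⟨fun _ => 1 / 2, ⟨fun v => by norm_num, fun u v _ => by norm_num⟩, ?_⟩
    have h : ∀ v, (1 / 2 : ℝ) = (lab v).weight (1 / 2) (1 / 2) (1 / 2) := by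
      intro v
      cases lab v <;> rfl
    rw [Finset.sum_congr rfl fun v _ => h v, hG.sum_weight]
    linarith
  · refine ⟨_, hG.weight_mem_iterate_cgClosure r, ?_⟩
    rw [hG.sum_weight]
    have ht : (2 : ℝ) ≤ 2 ^ r := by
      simpa using pow_le_pow_right₀ (one_le_two : (1 : ℝ) ≤ 2) hr0
    have h4 : (4 : ℝ) ^ r = 2 ^ r * 2 ^ r := by
      rw [← mul_pow]; norm_num
    rw [h4] at hr
    generalize (2 : ℝ) ^ r = t at ht hr
    -- From 3d > 2t² + 1 and 2t² + 1 - 3(t + 1) = (2t + 1)(t - 2) ≥ 0. Equality at t = 2 accounts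
    -- for the constants in (3d - 1) / 2.
    have hdt : t + 1 < d := by nlinarith
    have h1 : 1 < d / (t + 1) := by rwa [one_lt_div (by linarith)]
    have h2 : (n - d : ℝ) * 0 + d * (1 - 1 / (t + 1) + 2 * (1 / (t + 1))) = d + d / (t + 1) := by
      ring
    rw [h2]
    linarith

end StretchedClique

theorem proposition5p11 {V : Type*} [Fintype V] (n d : ℕ) (hd : 1 ≤ d) (hn : d + 2 ≤ n)
    (G : SimpleGraph V) (lab : V → StretchLabel n) (hG : IsStretchedClique n d G lab)
    (h₁ : ∀ (i j : Fin n) (u v : V), i ≠ j → lab u = StretchLabel.wing₁ i →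
      lab v = StretchLabel.wing₁ j → ¬ G.Adj u v)
    (h₂ : ∀ (i j : Fin n) (u v : V), i ≠ j → lab u = StretchLabel.wing₂ i →
      lab v = StretchLabel.wing₂ j → ¬ G.Adj u v) :
    ValidFor (stabPolytope G) (fun _ => 1) ((d : ℝ) + 1) ∧
      ∃ r : ℕ, IsCGRank (fracPolytope G) (fun _ => 1) ((d : ℝ) + 1) r ∧
        Real.logb 4 ((3 * (d : ℝ) - 1) / 2) ≤ (r : ℝ) := by
  classical
  have hfin : ∃ l : ℕ, ValidFor (cgClosure^[l] (fracPolytope G)) (fun _ => 1) ((d : ℝ) + 1) := by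
    have := validFor_iterate_cgClosure_rank (G := G) (d + 1) Finset.univ
      fun S _ hS => hG.card_le S hS
    simp only [Finset.mem_univ, if_true] at this
    push_cast at this
    exact ⟨_, this⟩
  refine ⟨?_, Nat.find hfin, ⟨Nat.find_spec hfin, fun l hl => Nat.find_min' hfin hl⟩, ?_⟩
  · have := validFor_stabPolytope (G := G) (d + 1) hG.card_le
    push_cast at this
    exact this
  · by_contra! hlt
    have hd' : (1 : ℝ) ≤ d := by exact_mod_cast hd
    rw [Real.lt_logb_iff_rpow_lt (by norm_num) (by linarith), Real.rpow_natCast] at hlt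
    obtain ⟨x, hx, hsum⟩ := hG.exists_lt_sum hd hn hlt
    have := Nat.find_spec hfin x hx
    simp only [Int.cast_one, one_mul] at this
    linarith
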